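/- \textbf{Theorem 2.} For graphs $F$ and $G$, a spanning subgraph $H\subseteq G$ is called $F$-saturated in $G$ if it is an inclusion-maximal $F$-free spanning subgraph of $G$ (where $F$-free means containing no copy of $F$ as a not necessarily induced subgraph), and $\mathrm{sat}(G,F)$ denotes the minimum number of edges of an $F$-saturated graph in $G$. Let $C_4$ be the cycle on $4$ vertices, and let $G(n,p)$ be the binomial random graph on $n$ labelled vertices, in which each pair of vertices is joined by an edge independently with probability $p$. Let $p\in(0,1)$ be fixed; ``whp'' means with probability tending to $1$ as $n\to\infty$. If $p>1-1/\sqrt[3]{7}$, then whp $$\mathrm{sat}(G(n,p),C_4)\le \frac{3(1+(1-p)^3)}{2(1-(1-p)^3)}\,n\,(1+o(1)).$$ If $p\le 1-1/\sqrt[3]{7}$, then whp $$\mathrm{sat}(G(n,p),C_4)\le\left(\frac{s+1}{2}+s(1-p)^s+\frac{s(1-p)^{2s}}{1-(1-p)^s}\right)n\,(1+o(1)),$$ where $s$ is the least positive integer such that $(2s^2+1)(1-p)^s<1$. In particular, for $p=1/2$, whp $\mathrm{sat}(G(n,p),C_4)\le\frac{27}{14}\,n\,(1+o(1))$. Here $o(1)$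 denotes a deterministic sequence (which may depend on $p$) tending to $0$ as $n\to\infty$. -/

import Mathlib

open Filter Topology

/-- `H` is `F`-saturated in `G`: `H` is an inclusion-maximal `F`-free spanning subgraph of `G`
(`F`-free: no copy of `F`, induced or not). -/
def IsSaturatedIn {V W : Type*} (F : SimpleGraph W) (G H : SimpleGraph V) : Prop :=
  Maximal (fun K : SimpleGraph V => K ≤ G ∧ F.Free K) H

/-- The saturation number `sat(G, F)`: the minimum number of edges of an `F`-saturated
graph in `G`. -/
noncomputable def satNumber {V W : Type*} (G : SimpleGraph V) (F : SimpleGraph W) : ℕ :=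
  sInf {m : ℕ | ∃ H : SimpleGraph V, IsSaturatedIn F G H ∧ H.edgeSet.ncard = m}

/-- On a finite vertex set the minimum defining `satNumber` is over a nonempty set whenever
`F` has an edge, hence it is attained. -/
theorem exists_isSaturatedIn_ncard_eq_satNumber {V W : Type*} [Finite V] (F : SimpleGraph W)
    (hF : F ≠ ⊥) (G : SimpleGraph V) :
    ∃ H : SimpleGraph V, IsSaturatedIn F G H ∧ H.edgeSet.ncard = satNumber G F := by
  have hne : {K : SimpleGraph V | K ≤ G ∧ F.Free K}.Nonempty := by
    refine ⟨⊥, bot_le, ?_⟩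
    rintro ⟨c⟩
    apply hF
    ext a b
    simp only [SimpleGraph.bot_adj, iff_false]
    intro hab
    simpa using c.toHom.map_adj hab
  obtain ⟨H, hH⟩ := (Set.toFinite {K : SimpleGraph V | K ≤ G ∧ F.Free K}).exists_maximal hne
  exact Nat.sInf_mem
    (s := {m : ℕ | ∃ H : SimpleGraph V, IsSaturatedIn F G H ∧ H.edgeSet.ncard = m})
    ⟨_, H, hH, rfl⟩

/-- The property `Q` of graphs on `n` labelled vertices holds with high probability for the
binomial random graph `G(n, p)`: its probability tends to `1` as `n → ∞`. -/
def Whp (p : unitInterval) (Q : ∀ n : ℕ, SimpleGraph (Fin n) → Prop) : Prop :=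
  Tendsto (fun n : ℕ => SimpleGraph.binomialRandom (Fin n) p {G | Q n G}) atTop (𝓝 1)

/-- Whp `sat(G(n, p), C₄) ≤ c n (1 + o(1))`, where `o(1)` is a deterministic sequence. -/
def WhpSatC4Le (p : unitInterval) (c : ℝ) : Prop :=
  ∃ δ : ℕ → ℝ, Tendsto δ atTop (𝓝 0) ∧
    Whp p (fun n G => (satNumber G (SimpleGraph.cycleGraph 4) : ℝ) ≤ c * n * (1 + δ n))

/-!
For all `p ∈ (0, 1)`, with `q = 1 - p`, whp
`sat(G(n, p), C₄) ≤ (3 / 2 + q³ (1 + q² + 1 / (1 - q)) + o(1)) n`, and this constant (`starConst q`)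
is at most each of the claimed ones.

No saturated graph has to be constructed explicitly. Choose centres `c 0, …, c (J - 1)`, join every
other vertex to the first centre adjacent to it in `G`, so that the vertices fall into `J` groups,
and join some centres to each other: `c 0, c 1, c 2` form a triangle, and `c 0` is joined to `c 3`
and `c 4`. This graph is `C₄`-free. In *every* `C₄`-free graph `H` containing it, each vertex has at
most one neighbour in each group other than the centre itself (two of them would close a 4-cycle
through the centre of the group), and there is no edge between groups whose centres are joined. So
`H` has at most `n` edges to centres and `n / 2` edges inside groups, up to `O(J²)`, and every other
edge goes from a vertex of some group `t` to one of the groups `i < t` with `c i`, `c t` not joined,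
at most one edge per pair of a vertex and a group. A maximal `C₄`-free `H ≤ G` that contains the
star forest is thus a saturated graph with few edges (`two_mul_satNumber_le`), and it remains to
bound the numbers `missCount i` of vertices adjacent to none of the first `i` centres.

In `G(n, p)` take `J ≈ n ^ (1 / 8)`. By Chebyshev's inequality `missCount i ≤ n q ^ i + n / J²` for
all `i < J` whp, and every vertex is adjacent to some centre whp. To have the required edges among
the first five centres, use `J` disjoint blocks of five vertices: whp one of them carries the
pattern, and the failure probabilities above are small enough for a union bound over the blocks.
-/

/-! ### Edge probabilities and pairwise independent events in the binomial random graph -/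

section Probability

open MeasureTheory ProbabilityTheory

theorem measurableSet_simpleGraph {V : Type*} [Finite V] (S : Set (SimpleGraph V)) :
    MeasurableSet S := by
  rw [← SimpleGraph.measurableEmbedding_edgeSet.measurableSet_image]
  exact (Set.toFinite _).measurableSet

/-- The edge indicators of the binomial random graph are independent: the probability that every
pair `e ∈ S` has a prescribed status is the product of the individual probabilities. -/
theorem binomialRandom_real_forall_mem {V : Type*} [Finite V] (p : unitInterval)
    (S : Finset (Sym2 V)) (hS : ∀ e ∈ S, ¬ e.IsDiag) (t : Set Prop) :
    (SimpleGraph.binomialRandom V p).real {G | ∀ e ∈ S, (e ∈ G.edgeSet) ∈ t} =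
      ((p : ℝ) * t.indicator 1 True + (1 - p) * t.indicator 1 False) ^ S.card := by
  classical
  have hmeas : MeasurableSet {G : SimpleGraph V | ∀ e ∈ S, (e ∈ G.edgeSet) ∈ t} :=
    measurableSet_simpleGraph _
  rw [measureReal_def, SimpleGraph.binomialRandom_eq_map,
    Measure.map_apply SimpleGraph.measurable_fromEdgeSet hmeas, setBernoulli_apply']
  have hset : ((fun q : Sym2 V → Prop => {i | q i}) ⁻¹'
      (SimpleGraph.fromEdgeSet ⁻¹' {G : SimpleGraph V | ∀ e ∈ S, (e ∈ G.edgeSet) ∈ t})) =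
      Set.pi S (fun _ => t) := by
    ext q
    simp only [Set.mem_preimage, Set.mem_ofPred_eq, Set.mem_pi, Finset.mem_coe,
      SimpleGraph.edgeSet_fromEdgeSet]
    refine forall₂_congr fun e he => ?_
    have : (e ∈ ({i | q i} \ Sym2.diagSet : Set (Sym2 V))) = q e := by
      simp [hS e he]
    rw [this]
  rw [hset, Measure.infinitePi_pi _ (fun _ _ => MeasurableSet.of_discrete), ENNReal.toReal_prod,
    ← Finset.prod_const]
  refine Finset.prod_congr rfl fun e he => ?_
  have h1 : (¬ e.IsDiag) = True := by simp [hS e he]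
  have h2 : (e ∈ (Sym2.diagSet : Set (Sym2 V))ᶜ) = True := by simp [hS e he]
  rw [h2]
  rw [← measureReal_def, measureReal_add_apply, measureReal_nnreal_smul_apply,
    measureReal_nnreal_smul_apply, measureReal_def, measureReal_def,
    Measure.dirac_apply, Measure.dirac_apply]
  congr 2 <;> simp [Set.indicator_apply, apply_ite]

/-- All pairs of `S` are non-edges with probability `(1 - p) ^ |S|`. -/
theorem binomialRandom_real_disjoint {V : Type*} [Finite V] (p : unitInterval)
    (S : Finset (Sym2 V)) (hS : ∀ e ∈ S, ¬ e.IsDiag) :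
    (SimpleGraph.binomialRandom V p).real {G | ∀ e ∈ S, e ∉ G.edgeSet} =
      (1 - p : ℝ) ^ S.card := by
  have h := binomialRandom_real_forall_mem p S hS {P | ¬ P}
  simpa using h

open Classical in
/-- Chebyshev's inequality for the number of pairwise independent, equally likely events that
occur. -/
theorem measureReal_abs_card_filter_sub_ge_le {Ω ι : Type*} [MeasurableSpace Ω] (μ : Measure Ω)
    [IsProbabilityMeasure μ] (s : Finset ι) (A : ι → Set Ω) (hA : ∀ i, MeasurableSet (A i))
    (r : ℝ) (h1 : ∀ i ∈ s, μ.real (A i) = r)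
    (h2 : ∀ i ∈ s, ∀ j ∈ s, i ≠ j → μ.real (A i ∩ A j) = r * r) (c : ℝ) (hc : 0 < c) :
    μ.real {ω | c ≤ |((s.filter fun i => ω ∈ A i).card : ℝ) - s.card * r|} ≤
      s.card * r / c ^ 2 := by
  set X : ι → Ω → ℝ := fun i => (A i).indicator 1 with hX
  have hmem : ∀ i, MemLp (X i) 2 μ := fun i =>
    (memLp_indicator_const 2 (hA i) (1 : ℝ) (Or.inr (measure_ne_top _ _)))
  have hint : ∀ i, μ[X i] = μ.real (A i) := fun i => by
    simp [hX, integral_indicator_one (hA i)]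
  have hmul : ∀ i j, X i * X j = (A i ∩ A j).indicator 1 := fun i j => by
    rw [hX, Set.inter_indicator_one]
  have hcov : ∀ i ∈ s, ∀ j ∈ s, i ≠ j → cov[X i, X j; μ] = 0 := fun i hi j hj hij => by
    rw [covariance_eq_sub (hmem i) (hmem j), hmul, hint, hint,
      integral_indicator_one ((hA i).inter (hA j)), h2 i hi j hj hij, h1 i hi, h1 j hj, sub_self]
  have hvar1 : ∀ i ∈ s, Var[X i; μ] ≤ r := fun i hi => by
    rw [variance_eq_sub (hmem i), pow_two, hmul, hint, integral_indicator_one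
      ((hA i).inter (hA i)), Set.inter_self, h1 i hi]
    nlinarith [sq_nonneg r]
  have hvar : Var[∑ i ∈ s, X i; μ] ≤ s.card * r := by
    rw [variance_sum' fun i _ => hmem i]
    have : ∀ i ∈ s, ∑ j ∈ s, cov[X i, X j; μ] ≤ r := fun i hi => by
      rw [Finset.sum_eq_single_of_mem i hi fun j hj hji => hcov i hi j hj hji.symm,
        covariance_self (hmem i).aemeasurable]
      exact hvar1 i hi
    simpa using Finset.sum_le_sum this
  have hsum : ∀ ω, (∑ i ∈ s, X i) ω = ((s.filter fun i => ω ∈ A i).card : ℝ) := fun ω => by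
    simp [hX, Set.indicator_apply, Finset.sum_apply, Finset.sum_boole]
  have hmean : μ[∑ i ∈ s, X i] = s.card * r := by
    have : ∫ ω, (∑ i ∈ s, X i) ω ∂μ = ∑ i ∈ s, ∫ ω, X i ω ∂μ := by
      simp only [Finset.sum_apply]
      exact integral_finsetSum _ fun i _ => (hmem i).integrable (by norm_num)
    rw [this, Finset.sum_congr rfl fun i hi => (hint i).trans (h1 i hi)]
    simp
  have key := meas_ge_le_variance_div_sq (memLp_finsetSum' s fun i _ => hmem i) hc (μ := μ)
  rw [hmean] at key
  simp only [hsum] at key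
  rw [measureReal_def]
  refine (ENNReal.toReal_le_of_le_ofReal ?_ key).trans ?_
  · exact div_nonneg (variance_nonneg _ _) (sq_nonneg _)
  · gcongr

end Probability

/-! ### `C₄`-free extensions of a star forest with joined centres -/

theorem free_cycleGraph_four_iff {V : Type*} (H : SimpleGraph V) :
    (SimpleGraph.cycleGraph 4).Free H ↔ ∀ a b c d : V, H.Adj a b → H.Adj b c → H.Adj c d →
      H.Adj d a → a = c ∨ b = d := by
  constructor
  · intro hF a b c d hab hbc hcd hda
    by_contra! hne
    obtain ⟨hac, hbd⟩ := hne
    have hadj : ∀ x y : Fin 4, (SimpleGraph.cycleGraph 4).Adj x y →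
        H.Adj (![a, b, c, d] x) (![a, b, c, d] y) := by
      intro x y hxy
      rw [SimpleGraph.cycleGraph_adj] at hxy
      fin_cases x <;> fin_cases y <;> first
        | exact absurd hxy (by decide)
        | simp_all [H.adj_comm]
    refine hF ⟨⟨![a, b, c, d], fun {x y} => hadj x y⟩, ?_⟩
    have hab' := hab.ne
    have hbc' := hbc.ne
    have hcd' := hcd.ne
    have hda' := hda.ne
    intro x y hxy
    fin_cases x <;> fin_cases y <;> simp_all
  · rintro h ⟨f⟩
    have hadj : ∀ x y : Fin 4, (x - y = 1 ∨ y - x = 1) → H.Adj (f x) (f y) := fun x y hxy =>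
      f.toHom.map_adj (SimpleGraph.cycleGraph_adj.2 hxy)
    rcases h (f 0) (f 1) (f 2) (f 3) (hadj _ _ (by decide)) (hadj _ _ (by decide))
      (hadj _ _ (by decide)) (hadj _ _ (by decide)) with h | h
    · exact absurd (f.injective h) (by decide)
    · exact absurd (f.injective h) (by decide)

/-- The pairs of (indices of) centres that are joined to each other: the triangle `0, 1, 2` with
the two further edges `03` and `04`. -/
def CentrePair (i j : ℕ) : Prop :=
  i ≠ j ∧ ((i = 0 ∧ j ≤ 4) ∨ (j = 0 ∧ i ≤ 4) ∨ (i ≤ 2 ∧ j ≤ 2))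

instance : DecidableRel CentrePair := fun i j => by unfold CentrePair; infer_instance

theorem CentrePair.symm {i j : ℕ} (h : CentrePair i j) : CentrePair j i := by
  unfold CentrePair at *; omega

/-- The graph formed by the joined centres contains no 4-cycle. -/
theorem CentrePair.eq_or_eq {i j k l : ℕ} (h₁ : CentrePair i j) (h₂ : CentrePair j k)
    (h₃ : CentrePair k l) (h₄ : CentrePair l i) : i = k ∨ j = l := by
  unfold CentrePair at *; omega

/-- The increments of the number of groups to which a vertex may have to be joined: a vertex of
group `t` can have neighbours in at most `∑ i ≤ t, costIncrement i` earlier groups. -/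
def costIncrement (i : ℕ) : ℕ := if i < 3 then 0 else if i = 3 ∨ i = 5 then 2 else 1

theorem costIncrement_le_two (i : ℕ) : costIncrement i ≤ 2 := by
  unfold costIncrement; split_ifs <;> omega

theorem card_filter_not_centrePair_le (t : ℕ) :
    ((Finset.range t).filter fun i => ¬ CentrePair i t).card ≤
      ∑ i ∈ Finset.range (t + 1), costIncrement i := by
  rcases lt_or_ge t 5 with ht | ht
  · interval_cases t <;> decide
  · refine (Finset.card_filter_le _ _).trans ?_
    rw [Finset.card_range]
    induction t, ht using Nat.le_induction with
    | base => decide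
    | succ t ht ih =>
      rw [Finset.sum_range_succ]
      have : costIncrement (t + 1) = 1 := by unfold costIncrement; split_ifs <;> omega
      omega

section Stars

variable {V : Type*} [DecidableEq V]

/-- The set of centres `c 0, …, c (J - 1)`. -/
def centres (c : ℕ → V) (J : ℕ) : Finset V := (Finset.range J).image c

/-- The star forest in which every vertex `v` outside the centres is joined to the centre
`c (T v)`, together with the edges `CentrePair` between centres. -/
def starGraph (c : ℕ → V) (J : ℕ) (T : V → ℕ) : SimpleGraph V :=
  SimpleGraph.fromRel fun u v => (u ∉ centres c J ∧ v = c (T u)) ∨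
    ∃ i < J, ∃ j < J, CentrePair i j ∧ u = c i ∧ v = c j

theorem mem_centres {c : ℕ → V} {J : ℕ} {v : V} : v ∈ centres c J ↔ ∃ i < J, c i = v := by
  simp [centres]

theorem starGraph_adj_centre {c : ℕ → V} {J : ℕ} {T : V → ℕ} (hT : ∀ v ∉ centres c J, T v < J)
    {v : V} (hv : v ∉ centres c J) : (starGraph c J T).Adj v (c (T v)) := by
  refine ⟨?_, Or.inl (Or.inl ⟨hv, rfl⟩)⟩
  rintro h
  exact hv (mem_centres.2 ⟨T v, hT v hv, h.symm⟩)

theorem starGraph_adj_of_centrePair {c : ℕ → V} {J : ℕ} {T : V → ℕ}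
    (hc : Set.InjOn c (Set.Iio J)) {i j : ℕ} (hi : i < J) (hj : j < J) (h : CentrePair i j) :
    (starGraph c J T).Adj (c i) (c j) :=
  ⟨fun h' => h.1 (hc hi hj h'), Or.inl (Or.inr ⟨i, hi, j, hj, h, rfl, rfl⟩)⟩

theorem starGraph_free {c : ℕ → V} {J : ℕ} {T : V → ℕ} (hc : Set.InjOn c (Set.Iio J))
    (hT : ∀ v ∉ centres c J, T v < J) :
    (SimpleGraph.cycleGraph 4).Free (starGraph c J T) := by
  rw [free_cycleGraph_four_iff]
  intro x y z w hxy hyz hzw hwx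
  -- A vertex outside the centres has a single neighbour, so it lies on no cycle.
  have hleaf : ∀ u v : V, u ∉ centres c J → (starGraph c J T).Adj u v → v = c (T u) := by
    rintro u v hu ⟨-, (⟨-, h⟩ | ⟨i, hi, j, hj, -, h, -⟩) | (⟨hv, h⟩ | ⟨i, hi, j, hj, -, -, h⟩)⟩
    · exact h
    · exact absurd (mem_centres.2 ⟨i, hi, h.symm⟩) hu
    · exact absurd (mem_centres.2 ⟨T v, hT v hv, h.symm⟩) hu
    · exact absurd (mem_centres.2 ⟨j, hj, h.symm⟩) hu
  have hpair : ∀ i < J, ∀ j < J, (starGraph c J T).Adj (c i) (c j) → CentrePair i j := by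
    rintro i hi j hj
      ⟨-, (⟨hv, -⟩ | ⟨k, hk, l, hl, h, h₁, h₂⟩) | (⟨hv, -⟩ | ⟨k, hk, l, hl, h, h₁, h₂⟩)⟩
    · exact absurd (mem_centres.2 ⟨i, hi, rfl⟩) hv
    · rwa [hc hi hk h₁, hc hj hl h₂]
    · exact absurd (mem_centres.2 ⟨j, hj, rfl⟩) hv
    · rw [hc hj hk h₁, hc hi hl h₂]; exact h.symm
  by_cases hx : x ∈ centres c J
  swap
  · exact Or.inr ((hleaf x y hx hxy).trans (hleaf x w hx hwx.symm).symm)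
  by_cases hy : y ∈ centres c J
  swap
  · exact Or.inl ((hleaf y x hy hxy.symm).trans (hleaf y z hy hyz).symm)
  by_cases hz : z ∈ centres c J
  swap
  · exact Or.inr ((hleaf z y hz hyz.symm).trans (hleaf z w hz hzw).symm)
  by_cases hw : w ∈ centres c J
  swap
  · exact Or.inl ((hleaf w x hw hwx).trans (hleaf w z hw hzw.symm).symm)
  obtain ⟨i, hi, rfl⟩ := mem_centres.1 hx
  obtain ⟨j, hj, rfl⟩ := mem_centres.1 hy
  obtain ⟨k, hk, rfl⟩ := mem_centres.1 hz
  obtain ⟨l, hl, rfl⟩ := mem_centres.1 hw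
  exact (CentrePair.eq_or_eq (hpair i hi j hj hxy) (hpair j hj k hk hyz) (hpair k hk l hl hzw)
    (hpair l hl i hi hwx)).imp (congrArg c) (congrArg c)

open Classical in
/-- A `C₄`-free graph containing the star forest has few edges: a vertex outside the centres has
at most one neighbour among the leaves of each star, since two of them would close a 4-cycle
through the centre, and there are no edges between the leaves of two stars whose centres are
joined. -/
theorem two_mul_ncard_edgeSet_le [Fintype V] {c : ℕ → V} {J : ℕ} {T : V → ℕ}
    (hc : Set.InjOn c (Set.Iio J)) (hT : ∀ v ∉ centres c J, T v < J) (H : SimpleGraph V)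
    (hle : starGraph c J T ≤ H) (hfree : (SimpleGraph.cycleGraph 4).Free H) :
    2 * H.edgeSet.ncard ≤ 3 * Fintype.card V + 3 * J ^ 2 +
      2 * (((Finset.univ \ centres c J) ×ˢ Finset.range J).filter fun x : V × ℕ =>
        x.2 < T x.1 ∧ ¬ CentrePair x.2 (T x.1)).card := by
  rw [free_cycleGraph_four_iff] at hfree
  set C := centres c J with hC
  set W := (((Finset.univ \ C) ×ˢ Finset.range J).filter fun x : V × ℕ =>
        x.2 < T x.1 ∧ ¬ CentrePair x.2 (T x.1)) with hW
  have hstar : ∀ v ∉ C, H.Adj v (c (T v)) := fun v hv => hle (starGraph_adj_centre hT hv)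
  have hTC : ∀ v ∉ C, c (T v) ∈ C := fun v hv => mem_centres.2 ⟨T v, hT v hv, rfl⟩
  have hne : ∀ v ∉ C, ∀ u ∈ C, v ≠ u := fun v hv u hu h => hv (h ▸ hu)
  -- Two leaves of one star have no common neighbour besides the centre.
  have hleaf : ∀ v u u', u ∉ C → u' ∉ C → T u = T u' → v ≠ c (T u) → H.Adj v u → H.Adj v u' →
      u = u' := by
    intro v u u' hu hu' hTu hv hvu hvu'
    have h := hstar u' hu'
    rw [← hTu] at h
    exact (hfree v u (c (T u)) u' hvu (hstar u hu) h.symm hvu'.symm).resolve_left hv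
  have hCcard : C.card ≤ J := by
    simpa [hC, centres] using Finset.card_image_le (s := Finset.range J) (f := c)
  -- Ordered adjacent pairs, sorted below by the positions of their two members.
  set P : Finset (V × V) := Finset.univ.filter fun x => H.Adj x.1 x.2 with hP
  have hPcard : P.card = 2 * H.edgeSet.ncard := by
    rw [Set.ncard_eq_toFinset_card', ← SimpleGraph.edgeFinset,
      ← H.sum_degrees_eq_twice_card_edges, hP, Finset.card_filter, Fintype.sum_prod_type]
    refine Finset.sum_congr rfl fun v _ => ?_
    rw [← Finset.card_filter, SimpleGraph.degree, SimpleGraph.neighborFinset_eq_filter]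
  set P₁ := P.filter fun x => x.1 ∈ C ∧ x.2 ∈ C with hP₁
  set P₂ := P.filter fun x => x.1 ∉ C ∧ x.2 ∈ C ∧ x.2 = c (T x.1) with hP₂
  set P₃ := P.filter fun x => x.1 ∉ C ∧ x.2 ∈ C ∧ x.2 ≠ c (T x.1) with hP₃
  set P₄ := P.filter fun x => x.1 ∉ C ∧ x.2 ∉ C ∧ T x.1 = T x.2 with hP₄
  set P₅ := P.filter fun x => x.1 ∉ C ∧ x.2 ∉ C ∧ T x.2 < T x.1 with hP₅
  have h₁ : P₁.card ≤ J ^ 2 := by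
    have : P₁ ⊆ C ×ˢ C := fun x hx => by
      simp only [hP₁, Finset.mem_filter] at hx
      exact Finset.mem_product.2 hx.2
    calc P₁.card ≤ (C ×ˢ C).card := Finset.card_le_card this
      _ ≤ J ^ 2 := by rw [Finset.card_product, pow_two]; gcongr
  have h₂ : P₂.card ≤ Fintype.card V := by
    refine Finset.card_le_card_of_injOn Prod.fst (fun _ _ => Finset.mem_univ _) ?_
    rintro ⟨v, u⟩ hx ⟨v', u'⟩ hx' (rfl : v = v')
    simp only [hP₂, Finset.coe_filter, Set.mem_ofPred_eq] at hx hx'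
    rw [hx.2.2.2, hx'.2.2.2]
  have h₃ : P₃.card ≤ J ^ 2 := by
    have : P₃.card ≤ (Finset.range J ×ˢ C).card := by
      refine Finset.card_le_card_of_injOn (fun x => (T x.1, x.2)) ?_ ?_
      · rintro ⟨v, u⟩ hx
        simp only [hP₃, Finset.coe_filter, Set.mem_ofPred_eq] at hx
        simpa using ⟨hT v hx.2.1, hx.2.2.1⟩
      · rintro ⟨v, u⟩ hx ⟨v', u'⟩ hx' hvv
        simp only [hP₃, hP, Finset.mem_filter, Finset.mem_univ, true_and,
          Finset.coe_filter, Set.mem_ofPred_eq] at hx hx'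
        obtain ⟨hTv, rfl⟩ := Prod.mk.inj hvv
        rw [hleaf u v v' hx.2.1 hx'.2.1 hTv hx.2.2.2 hx.1.symm hx'.1.symm]
    refine this.trans ?_
    rw [Finset.card_product, Finset.card_range, pow_two]
    gcongr
  have h₄ : P₄.card ≤ Fintype.card V := by
    refine Finset.card_le_card_of_injOn Prod.fst (fun _ _ => Finset.mem_univ _) ?_
    rintro ⟨v, u⟩ hx ⟨v', u'⟩ hx' (rfl : v = v')
    simp only [hP₄, hP, Finset.mem_filter, Finset.mem_univ, true_and,
      Finset.coe_filter, Set.mem_ofPred_eq] at hx hx'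
    rw [hleaf v u u' hx.2.2.1 hx'.2.2.1 (hx.2.2.2.symm.trans hx'.2.2.2)
      (hne v hx.2.1 _ (hTC u hx.2.2.1)) hx.1 hx'.1]
  have h₅ : P₅.card ≤ W.card := by
    refine Finset.card_le_card_of_injOn (fun x => (x.1, T x.2)) ?_ ?_
    · rintro ⟨v, u⟩ hx
      simp only [hP₅, hP, Finset.mem_filter, Finset.mem_univ, true_and,
        Finset.coe_filter, Set.mem_ofPred_eq] at hx
      obtain ⟨hadj, hv, hu, hlt⟩ := hx
      simp only [hW, Finset.coe_filter, Set.mem_ofPred_eq, Finset.mem_product, Finset.mem_sdiff,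
        Finset.mem_univ, true_and, Finset.mem_range]
      refine ⟨⟨hv, hT u hu⟩, hlt, fun hD => ?_⟩
      have hcc := hle (starGraph_adj_of_centrePair (T := T) hc (hT u hu) (hT v hv) hD)
      rcases hfree v u _ _ hadj (hstar u hu) hcc (hstar v hv).symm with h | h
      · exact hne v hv _ (hTC u hu) h
      · exact hne u hu _ (hTC v hv) h
    · rintro ⟨v, u⟩ hx ⟨v', u'⟩ hx' hvv
      simp only [hP₅, hP, Finset.mem_filter, Finset.mem_univ, true_and,
        Finset.coe_filter, Set.mem_ofPred_eq] at hx hx'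
      obtain ⟨rfl, hTu⟩ := Prod.mk.inj hvv
      rw [hleaf v u u' hx.2.2.1 hx'.2.2.1 hTu (hne v hx.2.1 _ (hTC u hx.2.2.1)) hx.1 hx'.1]
  have hcover : P ⊆ P₁ ∪ (P₂ ∪ P₃) ∪ (P₂ ∪ P₃).image Prod.swap ∪ P₄ ∪ P₅ ∪ P₅.image Prod.swap := by
    rintro ⟨v, u⟩ hx
    have hadj : H.Adj v u := by simpa [hP] using hx
    have hadj' := hadj.symm
    simp only [hP₁, hP₂, hP₃, hP₄, hP₅, hP, Finset.mem_union, Finset.mem_image, Finset.mem_filter,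
      Finset.mem_univ, true_and, Prod.exists, Prod.swap_prod_mk, Prod.mk.injEq]
    by_cases hv : v ∈ C <;> by_cases hu : u ∈ C
    · tauto
    · by_cases h : v = c (T u)
      · exact Or.inl (Or.inl (Or.inl (Or.inr ⟨u, v, Or.inl ⟨hadj', hu, hv, h⟩, rfl, rfl⟩)))
      · exact Or.inl (Or.inl (Or.inl (Or.inr ⟨u, v, Or.inr ⟨hadj', hu, hv, h⟩, rfl, rfl⟩)))
    · tauto
    · rcases lt_trichotomy (T u) (T v) with h | h | h
      · exact Or.inl (Or.inr ⟨hadj, hv, hu, h⟩)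
      · exact Or.inl (Or.inl (Or.inr ⟨hadj, hv, hu, h.symm⟩))
      · exact Or.inr ⟨u, v, ⟨hadj', hu, hv, h⟩, rfl, rfl⟩
  have := Finset.card_le_card hcover
  have u₁ := Finset.card_union_le (P₁ ∪ (P₂ ∪ P₃) ∪ (P₂ ∪ P₃).image Prod.swap ∪ P₄ ∪ P₅)
    (P₅.image Prod.swap)
  have u₂ := Finset.card_union_le (P₁ ∪ (P₂ ∪ P₃) ∪ (P₂ ∪ P₃).image Prod.swap ∪ P₄) P₅
  have u₃ := Finset.card_union_le (P₁ ∪ (P₂ ∪ P₃) ∪ (P₂ ∪ P₃).image Prod.swap) P₄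
  have u₄ := Finset.card_union_le (P₁ ∪ (P₂ ∪ P₃)) ((P₂ ∪ P₃).image Prod.swap)
  have u₅ := Finset.card_union_le P₁ (P₂ ∪ P₃)
  have u₆ := Finset.card_union_le P₂ P₃
  have i₁ := Finset.card_image_le (s := P₂ ∪ P₃) (f := Prod.swap)
  have i₂ := Finset.card_image_le (s := P₅) (f := Prod.swap)
  omega

end Stars

section Groups

variable {V : Type*} [DecidableEq V]

open Classical in
/-- The number of vertices outside the centres that are adjacent to none of the first `i`
centres. -/
noncomputable def missCount [Fintype V] (G : SimpleGraph V) (c : ℕ → V) (J i : ℕ) : ℕ :=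
  ((Finset.univ \ centres c J).filter fun v => ∀ k < i, ¬ G.Adj v (c k)).card

/-- If every vertex outside the centres is adjacent to some centre, and the first five centres
are suitably joined, then the star forest in which each vertex chooses its first adjacent
centre extends to a `C₄`-saturated graph, whose number of edges is controlled by the numbers of
vertices missed by the first centres. -/
theorem two_mul_satNumber_le [Fintype V] (G : SimpleGraph V) (c : ℕ → V) (J : ℕ)
    (hc : Set.InjOn c (Set.Iio J)) (hpair : ∀ i < J, ∀ j < J, CentrePair i j → G.Adj (c i) (c j))
    (hcover : missCount G c J J = 0) :
    2 * satNumber G (SimpleGraph.cycleGraph 4) ≤ 3 * Fintype.card V + 3 * J ^ 2 +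
      2 * ∑ i ∈ Finset.range J, costIncrement i * missCount G c J i := by
  classical
  set T : V → ℕ := fun v => sInf {i | G.Adj v (c i)}
  have hex : ∀ v ∉ centres c J, ∃ i < J, G.Adj v (c i) := by
    intro v hv
    by_contra! h
    have : v ∈ (Finset.univ \ centres c J).filter fun v => ∀ k < J, ¬ G.Adj v (c k) := by
      simpa [hv] using h
    rw [missCount, Finset.card_eq_zero] at hcover
    rw [hcover] at this
    exact absurd this (Finset.notMem_empty v)
  have hT : ∀ v ∉ centres c J, T v < J := fun v hv => by
    obtain ⟨i, hi, h⟩ := hex v hv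
    exact (Nat.sInf_le h).trans_lt hi
  have hTadj : ∀ v ∉ centres c J, G.Adj v (c (T v)) := fun v hv => by
    obtain ⟨i, hi, h⟩ := hex v hv
    exact Nat.sInf_mem (s := {i | G.Adj v (c i)}) ⟨i, h⟩
  have hTmin : ∀ v, ∀ i < T v, ¬ G.Adj v (c i) := fun v i hi => Nat.notMem_of_lt_sInf hi
  have hleG : starGraph c J T ≤ G := by
    rintro u v
      ⟨-, (⟨hu, rfl⟩ | ⟨i, hi, j, hj, h, rfl, rfl⟩) | (⟨hv, rfl⟩ | ⟨i, hi, j, hj, h, rfl, rfl⟩)⟩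
    · exact hTadj u hu
    · exact hpair i hi j hj h
    · exact (hTadj v hv).symm
    · exact hpair j hj i hi h.symm
  obtain ⟨H, hleH, hH⟩ := (Set.toFinite
    {K : SimpleGraph V | K ≤ G ∧ (SimpleGraph.cycleGraph 4).Free K}).exists_le_maximal
    (a := starGraph c J T) ⟨hleG, starGraph_free hc hT⟩
  have hsat : satNumber G (SimpleGraph.cycleGraph 4) ≤ H.edgeSet.ncard :=
    Nat.sInf_le ⟨H, hH, rfl⟩
  have hedge := two_mul_ncard_edgeSet_le hc hT H hleH hH.prop.2
  suffices hW : (((Finset.univ \ centres c J) ×ˢ Finset.range J).filter fun x : V × ℕ =>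
      x.2 < T x.1 ∧ ¬ CentrePair x.2 (T x.1)).card ≤
      ∑ i ∈ Finset.range J, costIncrement i * missCount G c J i by omega
  have hfib : ∀ v ∈ Finset.univ \ centres c J,
      ((Finset.range J).filter fun i => i < T v ∧ ¬ CentrePair i (T v)).card ≤
      ∑ i ∈ Finset.range J, if ∀ k < i, ¬ G.Adj v (c k) then costIncrement i else 0 := by
    intro v hv
    have hv' : v ∉ centres c J := by simpa using hv
    have hTJ := hT v hv'
    calc ((Finset.range J).filter fun i => i < T v ∧ ¬ CentrePair i (T v)).card
        ≤ ((Finset.range (T v)).filter fun i => ¬ CentrePair i (T v)).card := by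
          refine Finset.card_le_card fun i hi => ?_
          simp only [Finset.mem_filter, Finset.mem_range] at hi ⊢
          exact hi.2
      _ ≤ ∑ i ∈ Finset.range (T v + 1), costIncrement i := card_filter_not_centrePair_le _
      _ ≤ ∑ i ∈ Finset.range (T v + 1),
            if ∀ k < i, ¬ G.Adj v (c k) then costIncrement i else 0 := by
          refine Finset.sum_le_sum fun i hi => ?_
          rw [if_pos]
          intro k hk
          refine hTmin v k (hk.trans_le ?_)
          simpa [Nat.lt_succ_iff] using hi
      _ ≤ _ := Finset.sum_le_sum_of_subset (Finset.range_subset_range.2 hTJ)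
  calc _ = ∑ v ∈ Finset.univ \ centres c J,
        ((Finset.range J).filter fun i => i < T v ∧ ¬ CentrePair i (T v)).card := by
        rw [Finset.card_filter, Finset.sum_product]
        simp only [Finset.card_filter]
    _ ≤ _ := Finset.sum_le_sum hfib
    _ = _ := by
        rw [Finset.sum_comm]
        refine Finset.sum_congr rfl fun i _ => ?_
        rw [← Finset.sum_filter, Finset.sum_const, missCount, smul_eq_mul, mul_comm]

end Groups

/-! ### Numerical inequalities -/

/-- The constant in the upper bound on the saturation number, with `q = 1 - p`. The second summand
is the sum of the series `∑ i, costIncrement i * q ^ i`. -/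
noncomputable def starConst (q : ℝ) : ℝ := 3 / 2 + q ^ 3 * (1 + q ^ 2 + 1 / (1 - q))

theorem sum_costIncrement_mul_pow_le {q : ℝ} (hq0 : 0 ≤ q) (hq1 : q < 1) (J : ℕ) :
    ∑ i ∈ Finset.range J, (costIncrement i : ℝ) * q ^ i ≤ starConst q - 3 / 2 := by
  have h1q : 0 < 1 - q := by linarith
  -- From `6` on all increments are `1`, and the missing tail is a geometric series.
  have key : ∀ m, 6 ≤ m → ∑ i ∈ Finset.range m, (costIncrement i : ℝ) * q ^ i +
      q ^ m / (1 - q) = starConst q - 3 / 2 := by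
    intro m hm
    induction m, hm using Nat.le_induction with
    | base =>
      simp only [Finset.sum_range_succ, Finset.sum_range_zero, costIncrement, starConst]
      norm_num
      field_simp
      ring
    | succ m hm ih =>
      have : costIncrement m = 1 := by unfold costIncrement; split_ifs <;> omega
      rw [← ih, Finset.sum_range_succ, this]
      field_simp
      push_cast
      ring
  calc ∑ i ∈ Finset.range J, (costIncrement i : ℝ) * q ^ i
      ≤ ∑ i ∈ Finset.range (max J 6), (costIncrement i : ℝ) * q ^ i :=
        Finset.sum_le_sum_of_subset_of_nonneg (Finset.range_subset_range.2 (le_max_left _ _))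
          fun i _ _ => by positivity
    _ ≤ _ := by
        rw [← key _ (le_max_right J 6)]
        have : 0 ≤ q ^ max J 6 / (1 - q) := by positivity
        linarith

theorem starConst_le_of_pow_lt {q : ℝ} (hq0 : 0 < q) (hq : q ^ 3 < 1 / 7) :
    starConst q ≤ 3 * (1 + q ^ 3) / (2 * (1 - q ^ 3)) := by
  -- `11 / 20` is slightly above the cube root of `1 / 7`.
  have hq' : q < 11 / 20 := by
    by_contra! h
    have := pow_le_pow_left₀ (by norm_num) h 3
    norm_num at this
    linarith
  have h1 : 0 < 1 - q := by linarith
  have h3 : 0 < 1 - q ^ 3 := by linarith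
  have key : 1 + q ^ 2 + 1 / (1 - q) ≤ 3 / (1 - q ^ 3) := by
    have hfac : 1 / (1 - q) = (1 + q + q ^ 2) / (1 - q ^ 3) := by
      field_simp
      ring
    rw [hfac, ← sub_nonneg]
    have : 3 / (1 - q ^ 3) - (1 + q ^ 2 + (1 + q + q ^ 2) / (1 - q ^ 3)) =
        (1 - q - 2 * q ^ 2 + q ^ 3 + q ^ 5) / (1 - q ^ 3) := by
      field_simp
      ring
    rw [this]
    apply div_nonneg _ h3.le
    have : 0 < q ^ 5 := by positivity
    nlinarith [mul_pos hq0 hq0]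
  calc starConst q ≤ 3 / 2 + q ^ 3 * (3 / (1 - q ^ 3)) := by
        unfold starConst
        gcongr
    _ = _ := by
        field_simp
        ring

/-- For `q ≥ 1 / 2` the condition on `s` forces `s ≥ 7`, and then already the summand `(s + 1) / 2`
is large enough. -/
theorem starConst_le_of_half_le {q : ℝ} (hq1 : q < 1) (hq : 1 / 2 ≤ q) {s : ℕ} (hs0 : 0 < s)
    (hs : (2 * (s : ℝ) ^ 2 + 1) * q ^ s < 1) :
    starConst q ≤ ((s : ℝ) + 1) / 2 + s * q ^ s + s * q ^ (2 * s) / (1 - q ^ s) := by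
  have hq0 : 0 < q := by linarith
  have h1 : 0 < 1 - q := by linarith
  have hs7 : 7 ≤ s := by
    by_contra! h
    have h2 : (1 / 2 : ℝ) ^ s ≤ q ^ s := pow_le_pow_left₀ (by norm_num) hq s
    have h3 : (2 * (s : ℝ) ^ 2 + 1) * (1 / 2 : ℝ) ^ s < 1 :=
      lt_of_le_of_lt (by gcongr) hs
    interval_cases s <;> norm_num at h3
  have hs7' : (7 : ℝ) ≤ s := by exact_mod_cast hs7
  have hqs : q ^ s < 1 := pow_lt_one₀ hq0.le hq1 (by omega)
  -- Otherwise `1 / q < 1 + 2 / (s - 2)`, so that `1 / q ^ s` is at most `exp 3 < 27`, although it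
  -- exceeds `2 * s ^ 2 + 1 ≥ 99`.
  have hmain : q / (1 - q) ≤ s / 2 - 1 := by
    by_contra! h
    rw [lt_div_iff₀ h1] at h
    have h2 : (0 : ℝ) < s - 2 := by linarith
    have hinv : 1 / q ≤ 1 + 2 / (s - 2) := by
      rw [div_le_iff₀ hq0]
      have : (1 + 2 / ((s : ℝ) - 2)) * q = s * q / (s - 2) := by
        field_simp
        ring
      rw [this, le_div_iff₀ h2]
      nlinarith
    have hexp : (1 / q) ^ s ≤ Real.exp 3 := by
      calc (1 / q) ^ s ≤ (Real.exp (2 / (s - 2))) ^ s := by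
            gcongr
            linarith [Real.add_one_le_exp (2 / ((s : ℝ) - 2))]
        _ = Real.exp (s * (2 / (s - 2))) := by rw [← Real.exp_nat_mul]
        _ ≤ Real.exp 3 := by
            apply Real.exp_le_exp.2
            rw [← mul_div_assoc, div_le_iff₀ h2]
            linarith
    have he : Real.exp 3 < 27 := by
      have : Real.exp 3 = Real.exp 1 ^ 3 := by
        rw [← Real.exp_nat_mul]
        norm_num
      rw [this]
      calc Real.exp 1 ^ 3 < 3 ^ 3 := by
            gcongr
            linarith [Real.exp_one_lt_d9]
        _ = 27 := by norm_num
    have hlow : 2 * (s : ℝ) ^ 2 + 1 < (1 / q) ^ s := by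
      rw [one_div, inv_pow, ← one_div, lt_div_iff₀ (by positivity)]
      exact hs
    nlinarith
  have hA : starConst q ≤ 3 / 2 + q / (1 - q) := by
    have : q / (1 - q) - q ^ 3 * (1 + q ^ 2 + 1 / (1 - q)) = q + q ^ 2 - q ^ 3 - q ^ 5 := by
      field_simp
      ring
    have h2 : q ^ 3 ≤ q ^ 1 := pow_le_pow_of_le_one hq0.le hq1.le (by norm_num)
    have h3 : q ^ 5 ≤ q ^ 2 := pow_le_pow_of_le_one hq0.le hq1.le (by norm_num)
    unfold starConst
    linarith
  have hB : 0 ≤ s * q ^ s := by positivity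
  have hC : 0 ≤ s * q ^ (2 * s) / (1 - q ^ s) := div_nonneg (by positivity) (by linarith)
  linarith

theorem exists_pos_two_mul_sq_add_one_mul_pow_lt_one {q : ℝ} (hq0 : 0 < q) (hq1 : q < 1) :
    ∃ t : ℕ, 0 < t ∧ (2 * (t : ℝ) ^ 2 + 1) * q ^ t < 1 := by
  have h1 := tendsto_pow_const_mul_const_pow_of_lt_one 2 hq0.le hq1
  have h2 := tendsto_pow_atTop_nhds_zero_of_lt_one hq0.le hq1
  have h3 : Tendsto (fun t : ℕ => (2 * (t : ℝ) ^ 2 + 1) * q ^ t) atTop (𝓝 0) := by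
    have := (h1.const_mul 2).add h2
    simp only [mul_zero, add_zero] at this
    refine this.congr fun t => by ring
  obtain ⟨t, ht⟩ := ((h3.eventually (gt_mem_nhds one_pos)).and (eventually_gt_atTop 0)).exists
  exact ⟨t, ht.2, ht.1⟩

theorem seven_rpow_third_cube : (1 / (7 : ℝ) ^ (1 / 3 : ℝ)) ^ 3 = 1 / 7 := by
  rw [div_pow, one_pow, ← Real.rpow_natCast, ← Real.rpow_mul (by norm_num)]
  norm_num

/-! ### The random events -/

section RandomEvents

open MeasureTheory ProbabilityTheory

open Classical in
/-- Chebyshev's inequality for the number of those among pairwise disjoint sets of `k` pairs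
all of whose members have a prescribed status in the binomial random graph. -/
theorem binomialRandom_real_abs_card_filter_sub_ge_le {V ι : Type*} [Finite V] (p : unitInterval)
    (s : Finset ι) (E : ι → Finset (Sym2 V)) (k : ℕ) (hcard : ∀ a ∈ s, (E a).card = k)
    (hdiag : ∀ a ∈ s, ∀ e ∈ E a, ¬ e.IsDiag)
    (hdisj : ∀ a ∈ s, ∀ b ∈ s, a ≠ b → Disjoint (E a) (E b)) (t : Set Prop) (r : ℝ)
    (hr : (p : ℝ) * t.indicator 1 True + (1 - p) * t.indicator 1 False = r) (c : ℝ) (hc : 0 < c) :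
    (SimpleGraph.binomialRandom V p).real {G | c ≤
      |((s.filter fun a => ∀ e ∈ E a, (e ∈ G.edgeSet) ∈ t).card : ℝ) - s.card * r ^ k|} ≤
      s.card * r ^ k / c ^ 2 := by
  have h := measureReal_abs_card_filter_sub_ge_le (SimpleGraph.binomialRandom V p) s
    (fun a => {G | ∀ e ∈ E a, (e ∈ G.edgeSet) ∈ t}) (fun _ => measurableSet_simpleGraph _)
    (r ^ k) ?_ ?_ c hc
  · convert h
    rfl
  · intro a ha
    rw [binomialRandom_real_forall_mem p (E a) (hdiag a ha), hr, hcard a ha]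
  · intro a ha b hb hab
    have h := binomialRandom_real_forall_mem p (E a ∪ E b) (fun e he => by
      rcases Finset.mem_union.1 he with he | he
      exacts [hdiag a ha e he, hdiag b hb e he]) t
    rw [hr, Finset.card_union_of_disjoint (hdisj a ha b hb hab), hcard a ha, hcard b hb,
      pow_add] at h
    rw [← h]
    congr 1
    ext G
    simp [or_imp, forall_and]

/-- The ordered pairs `(i, j)` with `i < j` that are joined in the pattern of centres. -/
def patternPairs : Finset (ℕ × ℕ) := {(0, 1), (0, 2), (1, 2), (0, 3), (0, 4)}

theorem lt_of_mem_patternPairs {x : ℕ × ℕ} (hx : x ∈ patternPairs) : x.1 < x.2 ∧ x.2 < 5 := by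
  revert x; decide

theorem CentrePair.mem_patternPairs {i j : ℕ} (h : CentrePair i j) :
    (i, j) ∈ patternPairs ∨ (j, i) ∈ patternPairs := by
  have hi : i < 5 := by unfold CentrePair at h; omega
  have hj : j < 5 := by unfold CentrePair at h; omega
  interval_cases i <;> interval_cases j <;> revert h <;> decide

/-- Distinct blocks, and distinct positions in a block, give distinct pairs of vertices. -/
theorem blockEdges_inj {V : Type*} {φ : ℕ → V} {M : ℕ}
    (hφ : Set.InjOn φ (Set.Iio (5 * M))) {b b' : ℕ}
    (hb : b < M) (hb' : b' < M) {x x' : ℕ × ℕ} (hx : x ∈ patternPairs) (hx' : x' ∈ patternPairs)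
    (h : s(φ (5 * b + x.1), φ (5 * b + x.2)) = s(φ (5 * b' + x'.1), φ (5 * b' + x'.2))) :
    b = b' ∧ x = x' := by
  have h₁ := lt_of_mem_patternPairs hx
  have h₂ := lt_of_mem_patternPairs hx'
  have hlt : ∀ {b i}, b < M → i < 5 → 5 * b + i ∈ Set.Iio (5 * M) := fun {b i} hb hi => by
    rw [Set.mem_Iio]; omega
  rw [Prod.ext_iff]
  rcases Sym2.eq_iff.1 h with ⟨h, h'⟩ | ⟨h, h'⟩
  · have e₁ := hφ (hlt hb (by omega)) (hlt hb' (by omega)) h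
    have e₂ := hφ (hlt hb (by omega)) (hlt hb' (by omega)) h'
    omega
  · have e₁ := hφ (hlt hb (by omega)) (hlt hb' (by omega)) h
    have e₂ := hφ (hlt hb (by omega)) (hlt hb' (by omega)) h'
    omega

variable {V : Type*} [DecidableEq V]

/-- The pairs joining `v` to the first `i` centres. -/
def centreEdges (c : ℕ → V) (i : ℕ) (v : V) : Finset (Sym2 V) :=
  (Finset.range i).image fun k => s(v, c k)

theorem card_centreEdges {c : ℕ → V} {J i : ℕ} (hc : Set.InjOn c (Set.Iio J)) (hi : i ≤ J)
    (v : V) : (centreEdges c i v).card = i := by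
  rw [centreEdges, Finset.card_image_of_injOn, Finset.card_range]
  intro k hk l hl h
  simp only [Finset.coe_range, Set.mem_Iio] at hk hl
  exact hc (hk.trans_le hi) (hl.trans_le hi) (Sym2.congr_right.1 h)

theorem not_isDiag_of_mem_centreEdges {c : ℕ → V} {J i : ℕ} (hi : i ≤ J) {v : V}
    (hv : v ∉ centres c J) {e : Sym2 V} (he : e ∈ centreEdges c i v) : ¬ e.IsDiag := by
  obtain ⟨k, hk, rfl⟩ := Finset.mem_image.1 he
  rw [Sym2.mk_isDiag_iff]
  rintro rfl
  exact hv (mem_centres.2 ⟨k, (Finset.mem_range.1 hk).trans_le hi, rfl⟩)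

theorem disjoint_centreEdges {c : ℕ → V} {J i : ℕ} (hi : i ≤ J) {v w : V}
    (hv : v ∉ centres c J) (hvw : v ≠ w) :
    Disjoint (centreEdges c i v) (centreEdges c i w) := by
  rw [Finset.disjoint_left]
  intro e he he'
  obtain ⟨k, hk, rfl⟩ := Finset.mem_image.1 he
  obtain ⟨l, hl, h⟩ := Finset.mem_image.1 he'
  rcases Sym2.eq_iff.1 h with ⟨h, -⟩ | ⟨-, h⟩
  · exact hvw h.symm
  · exact hv (mem_centres.2 ⟨l, (Finset.mem_range.1 hl).trans_le hi, h⟩)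

/-- The number of vertices missed by the first `i` centres is unlikely to exceed its mean by
much. -/
theorem binomialRandom_real_missCount_ge_le [Fintype V] (p : unitInterval) {c : ℕ → V} {J i : ℕ}
    (hc : Set.InjOn c (Set.Iio J)) (hi : i ≤ J) (t : ℝ) (ht : 0 < t) :
    (SimpleGraph.binomialRandom V p).real
      {G | Fintype.card V * (1 - p : ℝ) ^ i + t ≤ missCount G c J i} ≤
      Fintype.card V / t ^ 2 := by
  classical
  have hq0 : (0 : ℝ) ≤ 1 - p := by linarith [p.2.2]
  have hq1 : (1 - p : ℝ) ≤ 1 := by linarith [p.2.1]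
  have hmem : ∀ v ∈ Finset.univ \ centres c J, v ∉ centres c J := by simp
  have h := binomialRandom_real_abs_card_filter_sub_ge_le p (Finset.univ \ centres c J)
    (centreEdges c i) i (fun v _ => card_centreEdges hc hi v)
    (fun v hv e he => not_isDiag_of_mem_centreEdges hi (hmem v hv) he)
    (fun v hv w _ hvw => disjoint_centreEdges hi (hmem v hv) hvw) {P | ¬ P} (1 - p) (by simp) t ht
  have hcard : ((Finset.univ \ centres c J).card : ℝ) ≤ Fintype.card V := by
    exact_mod_cast Finset.card_le_univ _
  refine (measureReal_mono ?_ (measure_ne_top _ _)).trans (h.trans ?_)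
  · intro G hG
    rw [Set.mem_ofPred_eq] at hG ⊢
    have heq : ∀ _ : DecidablePred fun v => ∀ e ∈ centreEdges c i v,
        (e ∈ G.edgeSet) ∈ {P : Prop | ¬ P}, missCount G c J i = ((Finset.univ \ centres c J).filter
        fun v => ∀ e ∈ centreEdges c i v, (e ∈ G.edgeSet) ∈ {P : Prop | ¬ P}).card := by
      intro _
      rw [missCount]
      congr 1
      refine Finset.filter_congr fun v _ => ?_
      simp [centreEdges]
    rw [← heq]
    refine le_trans ?_ (le_abs_self _)
    have := mul_le_mul_of_nonneg_right hcard (pow_nonneg hq0 i)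
    linarith
  · gcongr
    calc ((Finset.univ \ centres c J).card : ℝ) * (1 - p) ^ i
        ≤ Fintype.card V * 1 := by
          gcongr
          exact pow_le_one₀ hq0 hq1
      _ = _ := mul_one _

/-- It is unlikely that some vertex is adjacent to no centre. -/
theorem binomialRandom_real_missCount_ne_zero_le [Fintype V] (p : unitInterval) {c : ℕ → V}
    {J : ℕ} (hc : Set.InjOn c (Set.Iio J)) :
    (SimpleGraph.binomialRandom V p).real {G | missCount G c J J ≠ 0} ≤
      Fintype.card V * (1 - p : ℝ) ^ J := by
  classical
  have hq0 : (0 : ℝ) ≤ 1 - p := by linarith [p.2.2]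
  have hsub : {G : SimpleGraph V | missCount G c J J ≠ 0} ⊆
      ⋃ v ∈ Finset.univ \ centres c J, {G | ∀ e ∈ centreEdges c J v, e ∉ G.edgeSet} := by
    intro G hG
    obtain ⟨v, hv⟩ := Finset.card_pos.1 (Nat.pos_of_ne_zero hG)
    rw [Finset.mem_filter] at hv
    refine Set.mem_biUnion hv.1 ?_
    simpa [centreEdges] using hv.2
  refine (measureReal_mono hsub (measure_ne_top _ _)).trans
    ((measureReal_biUnion_finset_le _ _).trans ?_)
  have : ∀ v ∈ Finset.univ \ centres c J, (SimpleGraph.binomialRandom V p).real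
      {G | ∀ e ∈ centreEdges c J v, e ∉ G.edgeSet} = (1 - p : ℝ) ^ J := fun v hv => by
    rw [binomialRandom_real_disjoint p _ fun e he =>
      not_isDiag_of_mem_centreEdges le_rfl (by simpa using hv) he, card_centreEdges hc le_rfl]
  rw [Finset.sum_congr rfl this, Finset.sum_const, nsmul_eq_mul]
  gcongr
  exact Finset.card_le_univ _

/-- The pairs of vertices that have to be edges for the `b`-th block of five vertices of the
sequence `φ` to carry the pattern of centres. -/
def blockEdges (φ : ℕ → V) (b : ℕ) : Finset (Sym2 V) :=
  patternPairs.image fun x => s(φ (5 * b + x.1), φ (5 * b + x.2))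

open Classical in
/-- Among many disjoint blocks of five vertices one is likely to carry the pattern of centres. -/
theorem binomialRandom_real_no_block_le [Finite V] (p : unitInterval) (hp : 0 < (p : ℝ))
    {φ : ℕ → V} {M : ℕ} (hM : 0 < M) (hφ : Set.InjOn φ (Set.Iio (5 * M))) :
    (SimpleGraph.binomialRandom V p).real
      {G | ∀ b < M, ¬ ∀ e ∈ blockEdges φ b, e ∈ G.edgeSet} ≤ 1 / (M * (p : ℝ) ^ 5) := by
  have hM' : (0 : ℝ) < M := by exact_mod_cast hM
  have h := binomialRandom_real_abs_card_filter_sub_ge_le p (Finset.range M) (blockEdges φ) 5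
    (fun b hb => by
      rw [blockEdges, Finset.card_image_of_injOn]
      · decide
      · intro x hx x' hx' h
        have hb := Finset.mem_range.1 hb
        exact (blockEdges_inj hφ hb hb hx hx' h).2)
    (fun b hb e he => by
      obtain ⟨x, hx, rfl⟩ := Finset.mem_image.1 he
      have hb := Finset.mem_range.1 hb
      have hlt := lt_of_mem_patternPairs hx
      rw [Sym2.mk_isDiag_iff]
      intro h
      have := hφ (by rw [Set.mem_Iio]; omega) (by rw [Set.mem_Iio]; omega) h
      omega)
    (fun b hb b' hb' hbb => by
      rw [Finset.disjoint_left]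
      intro e he he'
      obtain ⟨x, hx, rfl⟩ := Finset.mem_image.1 he
      obtain ⟨x', hx', h⟩ := Finset.mem_image.1 he'
      exact hbb (blockEdges_inj hφ (Finset.mem_range.1 hb) (Finset.mem_range.1 hb') hx hx'
        h.symm).1)
    {P | P} p (by simp) (M * (p : ℝ) ^ 5) (by positivity)
  refine (measureReal_mono ?_ (measure_ne_top _ _)).trans (h.trans (le_of_eq ?_))
  · intro G hG
    simp only [Set.mem_ofPred_eq] at hG ⊢
    rw [Finset.filter_false_of_mem fun b hb => hG b (Finset.mem_range.1 hb)]
    simp [abs_of_pos hM', abs_of_pos hp]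
  · rw [Finset.card_range]
    field_simp

end RandomEvents

/-! ### The bound with high probability -/

section Whp

open MeasureTheory ProbabilityTheory

theorem whp_of_tendsto_zero {p : unitInterval} {Q : ∀ n : ℕ, SimpleGraph (Fin n) → Prop}
    {u : ℕ → ℝ} (hu : Tendsto u atTop (𝓝 0))
    (h : ∀ᶠ n in atTop, (SimpleGraph.binomialRandom (Fin n) p).real {G | ¬ Q n G} ≤ u n) :
    Whp p Q := by
  have hreal : Tendsto (fun n => (SimpleGraph.binomialRandom (Fin n) p).real {G | Q n G}) atTop
      (𝓝 1) := by
    refine tendsto_of_tendsto_of_tendsto_of_le_of_le' (g := fun n => 1 - u n) (h := fun _ => 1)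
      (by simpa using hu.const_sub 1) tendsto_const_nhds ?_ (.of_forall fun n => measureReal_le_one)
    filter_upwards [h] with n hn
    have := probReal_compl_eq_one_sub (μ := SimpleGraph.binomialRandom (Fin n) p)
      (measurableSet_simpleGraph {G | Q n G})
    have hc : {G : SimpleGraph (Fin n) | Q n G}ᶜ = {G | ¬ Q n G} := rfl
    rw [hc] at this
    linarith
  have := ENNReal.tendsto_ofReal hreal
  rw [ENNReal.ofReal_one] at this
  refine this.congr fun n => ?_
  rw [ofReal_measureReal]

/-- The sign of `δ n` is not controlled, hence `|δ n|` in the bound for the larger constant. -/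
theorem WhpSatC4Le.mono {p : unitInterval} {c c' : ℝ} (hc : 0 ≤ c) (hcc : c ≤ c')
    (h : WhpSatC4Le p c) : WhpSatC4Le p c' := by
  obtain ⟨δ, hδ, h⟩ := h
  refine ⟨fun n => |δ n|, by simpa using hδ.abs, ?_⟩
  refine tendsto_of_tendsto_of_tendsto_of_le_of_le h tendsto_const_nhds
    (fun n => measure_mono fun G hG => ?_) (fun n => prob_le_one)
  simp only [Set.mem_ofPred_eq] at hG ⊢
  refine hG.trans ?_
  calc c * n * (1 + δ n) ≤ c * n * (1 + |δ n|) := by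
        gcongr
        exact le_abs_self _
    _ ≤ c' * n * (1 + |δ n|) := by gcongr

/-- The centres built on the `b`-th block: its five vertices, followed by vertices that lie in no
block. -/
def blockCentres {V : Type*} (φ : ℕ → V) (J b i : ℕ) : V :=
  φ (if i < 5 then 5 * b + i else 5 * J + i)

theorem injOn_blockCentres {V : Type*} {φ : ℕ → V} {J b : ℕ}
    (hφ : Set.InjOn φ (Set.Iio (6 * J))) (hb : b < J) :
    Set.InjOn (blockCentres φ J b) (Set.Iio J) := by
  intro i hi j hj h
  rw [Set.mem_Iio] at hi hj
  have := hφ (by rw [Set.mem_Iio]; split_ifs <;> omega) (by rw [Set.mem_Iio]; split_ifs <;> omega) h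
  split_ifs at this <;> omega

/-- The bound on the saturation number for graphs in which some block carries the pattern of
centres and the centres built on it miss about as many vertices as expected. -/
theorem satNumber_le_of_block {V : Type*} [Fintype V] [DecidableEq V] (G : SimpleGraph V)
    {φ : ℕ → V} {J b : ℕ} (hφ : Set.InjOn φ (Set.Iio (6 * J))) (hb : b < J) {q t : ℝ}
    (hq0 : 0 ≤ q) (hq1 : q < 1) (ht : 0 ≤ t)
    (hblock : ∀ e ∈ blockEdges φ b, e ∈ G.edgeSet)
    (hcover : missCount G (blockCentres φ J b) J J = 0)
    (hmiss : ∀ i < J, (missCount G (blockCentres φ J b) J i : ℝ) ≤ Fintype.card V * q ^ i + t) :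
    (satNumber G (SimpleGraph.cycleGraph 4) : ℝ) ≤
      starConst q * Fintype.card V + 2 * J ^ 2 + 2 * J * t := by
  have hpair : ∀ i j, CentrePair i j →
      G.Adj (blockCentres φ J b i) (blockCentres φ J b j) := by
    intro i j h
    have key : ∀ i j, (i, j) ∈ patternPairs →
        G.Adj (blockCentres φ J b i) (blockCentres φ J b j) := fun i j h => by
      have hlt := lt_of_mem_patternPairs h
      have := hblock _ (Finset.mem_image_of_mem _ h)
      simp only at hlt
      rwa [SimpleGraph.mem_edgeSet, ← if_pos (c := i < 5) (t := 5 * b + i) (e := 5 * J + i)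
        (by omega), ← if_pos (c := j < 5) (t := 5 * b + j) (e := 5 * J + j) (by omega)] at this
    rcases h.mem_patternPairs with h | h
    exacts [key i j h, (key j i h).symm]
  have h := two_mul_satNumber_le G (blockCentres φ J b) J (injOn_blockCentres hφ hb)
    (fun i _ j _ => hpair i j) hcover
  have h' : 2 * (satNumber G (SimpleGraph.cycleGraph 4) : ℝ) ≤ 3 * Fintype.card V + 3 * J ^ 2 +
      2 * ∑ i ∈ Finset.range J,
        (costIncrement i : ℝ) * missCount G (blockCentres φ J b) J i := by
    exact_mod_cast h
  have hsum : ∑ i ∈ Finset.range J,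
      (costIncrement i : ℝ) * missCount G (blockCentres φ J b) J i ≤
      Fintype.card V * (starConst q - 3 / 2) + J * (2 * t) := by
    calc ∑ i ∈ Finset.range J, (costIncrement i : ℝ) * missCount G (blockCentres φ J b) J i
        ≤ ∑ i ∈ Finset.range J, (Fintype.card V * ((costIncrement i : ℝ) * q ^ i) + 2 * t) := by
          refine Finset.sum_le_sum fun i hi => ?_
          have h1 := hmiss i (Finset.mem_range.1 hi)
          have h2 : (costIncrement i : ℝ) ≤ 2 := by exact_mod_cast costIncrement_le_two i
          have h3 : (0 : ℝ) ≤ costIncrement i := Nat.cast_nonneg _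
          nlinarith [mul_le_mul_of_nonneg_left h1 h3, mul_le_mul_of_nonneg_right h2 ht]
      _ = Fintype.card V * ∑ i ∈ Finset.range J, (costIncrement i : ℝ) * q ^ i + J * (2 * t) := by
          rw [Finset.sum_add_distrib, ← Finset.mul_sum]
          simp
      _ ≤ _ := by
          gcongr
          exact sum_costIncrement_mul_pow_le hq0 hq1 J
  have : (0 : ℝ) ≤ (J : ℝ) ^ 2 := by positivity
  linarith

/-- The number of centres used on `n` vertices: the integer part of the eighth root of `n`. -/
noncomputable def numCentres (n : ℕ) : ℕ := ⌊(n : ℝ) ^ (1 / 8 : ℝ)⌋₊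

theorem numCentres_pow_le (n : ℕ) : (numCentres n : ℝ) ^ 8 ≤ (n : ℝ) := by
  calc (numCentres n : ℝ) ^ 8 ≤ ((n : ℝ) ^ (1 / 8 : ℝ)) ^ 8 := by
        gcongr
        exact Nat.floor_le (by positivity)
    _ = (n : ℝ) := by
        rw [← Real.rpow_natCast, ← Real.rpow_mul (by positivity)]
        norm_num

theorem le_numCentres_add_one_pow (n : ℕ) : (n : ℝ) ≤ ((numCentres n : ℝ) + 1) ^ 8 := by
  calc (n : ℝ) = ((n : ℝ) ^ (1 / 8 : ℝ)) ^ 8 := by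
        rw [← Real.rpow_natCast, ← Real.rpow_mul (by positivity)]
        norm_num
    _ ≤ _ := by
        gcongr
        exact (Nat.lt_floor_add_one _).le

theorem tendsto_numCentres : Tendsto numCentres atTop atTop :=
  tendsto_nat_floor_atTop.comp
    ((tendsto_rpow_atTop (by norm_num)).comp tendsto_natCast_atTop_atTop)

/-- The sum of the failure probabilities vanishes as the number `J` of centres grows: the summands
stand for the absence of a suitable block, for vertices adjacent to no centre, and for deviations
of `missCount`. -/
theorem tendsto_failure_bound {p q : ℝ} (hq0 : 0 < q) (hq1 : q < 1) :
    Tendsto (fun J : ℕ => 1 / ((J : ℝ) * p ^ 5) + ((J : ℝ) + 1) ^ 9 * q ^ J + 1 / (J : ℝ)) atTop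
      (𝓝 0) := by
  have h1 : Tendsto (fun J : ℕ => 1 / ((J : ℝ) * p ^ 5)) atTop (𝓝 0) := by
    have := tendsto_one_div_atTop_nhds_zero_nat (𝕜 := ℝ) |>.mul_const (1 / p ^ 5)
    simp only [zero_mul] at this
    exact this.congr fun J => by rw [one_div_mul_one_div]
  have h2 : Tendsto (fun J : ℕ => ((J : ℝ) + 1) ^ 9 * q ^ J) atTop (𝓝 0) := by
    have := ((tendsto_pow_const_mul_const_pow_of_lt_one 9 hq0.le hq1).comp
      (tendsto_add_atTop_nat 1)).const_mul q⁻¹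
    simp only [mul_zero] at this
    refine this.congr fun J => ?_
    simp only [Function.comp_apply]
    push_cast
    field_simp
    exact pow_succ' q J
  simpa using (h1.add h2).add (tendsto_one_div_atTop_nhds_zero_nat (𝕜 := ℝ))

/-- One bound for all `p`, from which the three claims follow by comparing constants. -/
theorem whpSatC4Le_starConst (p : unitInterval) (hp0 : 0 < (p : ℝ)) (hp1 : (p : ℝ) < 1) :
    WhpSatC4Le p (starConst (1 - p)) := by
  have hq0 : (0 : ℝ) < 1 - p := by linarith
  have hq1 : (1 - p : ℝ) < 1 := by linarith
  have hone : 1 ≤ starConst (1 - p) := by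
    have : 0 ≤ (1 - p : ℝ) ^ 3 * (1 + (1 - p) ^ 2 + 1 / (1 - (1 - p))) := by
      rw [sub_sub_cancel]
      positivity
    unfold starConst
    linarith
  refine ⟨fun n => 4 / (numCentres n : ℝ), ?_, ?_⟩
  · exact (tendsto_const_div_atTop_nhds_zero_nat 4).comp tendsto_numCentres
  refine whp_of_tendsto_zero
    ((tendsto_failure_bound (p := p) hq0 hq1).comp tendsto_numCentres) ?_
  filter_upwards [tendsto_numCentres.eventually_ge_atTop 2] with n hJ2
  set J := numCentres n with hJ
  have hJ2' : (2 : ℝ) ≤ J := by exact_mod_cast hJ2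
  have hJn : (J : ℝ) ^ 8 ≤ n := numCentres_pow_le n
  have hnJ : (n : ℝ) ≤ ((J : ℝ) + 1) ^ 8 := le_numCentres_add_one_pow n
  have hn6 : 6 * J ≤ n := by
    have h1 : J ^ 8 ≤ n := by exact_mod_cast hJn
    have h2 : 2 ^ 7 ≤ J ^ 7 := Nat.pow_le_pow_left hJ2 7
    nlinarith
  have hn0 : 0 < n := by omega
  have hn0' : (0 : ℝ) < n := by exact_mod_cast hn0
  set φ : ℕ → Fin n := fun i => ⟨i % n, Nat.mod_lt _ hn0⟩ with hφdef
  have hφ : Set.InjOn φ (Set.Iio (6 * J)) := by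
    intro i hi j hj h
    rw [Set.mem_Iio] at hi hj
    have := Fin.mk.inj h
    rwa [Nat.mod_eq_of_lt (by omega), Nat.mod_eq_of_lt (by omega)] at this
  -- The permitted deviation: the `J` deviations add up to `O(n / J)`.
  set t : ℝ := n / J ^ 2 with ht
  have ht0 : 0 < t := by positivity
  set μ := SimpleGraph.binomialRandom (Fin n) p with hμ
  set B : Set (SimpleGraph (Fin n)) := {G | ∀ b < J, ¬ ∀ e ∈ blockEdges φ b, e ∈ G.edgeSet}
  set D : ℕ → Set (SimpleGraph (Fin n)) := fun b => {G | missCount G (blockCentres φ J b) J J ≠ 0}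
  set F : ℕ → ℕ → Set (SimpleGraph (Fin n)) := fun b i =>
    {G | Fintype.card (Fin n) * (1 - p : ℝ) ^ i + t ≤ missCount G (blockCentres φ J b) J i}
  have hB : μ.real B ≤ 1 / (J * (p : ℝ) ^ 5) :=
    binomialRandom_real_no_block_le p hp0 (by omega)
      (hφ.mono (Set.Iio_subset_Iio (by omega)))
  have hD : ∀ b ∈ Finset.range J, μ.real (D b) ≤ n * (1 - p : ℝ) ^ J := fun b hb => by
    simpa using binomialRandom_real_missCount_ne_zero_le p
      (injOn_blockCentres hφ (Finset.mem_range.1 hb))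
  have hF : ∀ b ∈ Finset.range J, ∀ i ∈ Finset.range J, μ.real (F b i) ≤ n / t ^ 2 :=
    fun b hb i hi =>
    (binomialRandom_real_missCount_ge_le p (injOn_blockCentres hφ (Finset.mem_range.1 hb))
      (Finset.mem_range.1 hi).le t ht0).trans_eq (by rw [Fintype.card_fin])
  have hsub : {G : SimpleGraph (Fin n) | ¬ (satNumber G (SimpleGraph.cycleGraph 4) : ℝ) ≤
      starConst (1 - p) * n * (1 + 4 / (J : ℝ))} ⊆
      B ∪ ⋃ b ∈ Finset.range J, (D b ∪ ⋃ i ∈ Finset.range J, F b i) := by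
    intro G hG
    by_contra hnot
    apply hG
    simp only [Set.mem_union, Set.mem_iUnion, Finset.mem_range, not_or, not_exists] at hnot
    obtain ⟨hnB, hnot⟩ := hnot
    have hnB' : ∃ b < J, ∀ e ∈ blockEdges φ b, e ∈ G.edgeSet := by
      by_contra! hall
      exact hnB fun b hb hforall => by
        obtain ⟨e, he, he'⟩ := hall b hb
        exact he' (hforall e he)
    obtain ⟨b, hb, hblock⟩ := hnB'
    obtain ⟨hcover, hmiss⟩ := hnot b hb
    have := satNumber_le_of_block G hφ hb hq0.le hq1 ht0.le hblock
      (by simpa [D] using hcover) (fun i hi => (not_le.1 (hmiss i hi)).le)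
    rw [Fintype.card_fin] at this
    refine this.trans ?_
    have h1 : (J : ℝ) * t = n / J := by
      rw [ht]
      field_simp
    have h2 : (J : ℝ) ^ 2 ≤ n / J := by
      rw [le_div_iff₀ (by linarith)]
      calc (J : ℝ) ^ 2 * J = (J : ℝ) ^ 3 := by ring
        _ ≤ (J : ℝ) ^ 8 := pow_le_pow_right₀ (by linarith) (by norm_num)
        _ ≤ n := hJn
    have h3 : starConst (1 - p) * n * (1 + 4 / (J : ℝ)) =
        starConst (1 - p) * n + 4 * (starConst (1 - p) * (n / J)) := by ring
    have h4 : (n : ℝ) / J ≤ starConst (1 - p) * (n / J) :=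
      le_mul_of_one_le_left (by positivity) hone
    rw [h3]
    linarith
  have hbound : ∀ b ∈ Finset.range J, μ.real (D b ∪ ⋃ i ∈ Finset.range J, F b i) ≤
      n * (1 - p : ℝ) ^ J + J * (n / t ^ 2) := fun b hb => by
    refine (measureReal_union_le _ _).trans (add_le_add (hD b hb) ?_)
    refine (measureReal_biUnion_finset_le _ _).trans ?_
    simpa using Finset.sum_le_sum (hF b hb)
  calc μ.real _ ≤ μ.real (B ∪ ⋃ b ∈ Finset.range J, (D b ∪ ⋃ i ∈ Finset.range J, F b i)) :=
        measureReal_mono hsub (measure_ne_top _ _)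
    _ ≤ 1 / (J * (p : ℝ) ^ 5) + J * (n * (1 - p : ℝ) ^ J + J * (n / t ^ 2)) := by
        refine (measureReal_union_le _ _).trans (add_le_add hB ?_)
        refine (measureReal_biUnion_finset_le _ _).trans ?_
        exact (Finset.sum_le_sum hbound).trans_eq
          (by rw [Finset.sum_const, Finset.card_range, nsmul_eq_mul])
    _ ≤ _ := by
        simp only [Function.comp_apply, ← hJ]
        have e1 : (J : ℝ) * (n * (1 - p : ℝ) ^ J) ≤ ((J : ℝ) + 1) ^ 9 * (1 - p) ^ J := by
          calc (J : ℝ) * (n * (1 - p : ℝ) ^ J)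
              ≤ ((J : ℝ) + 1) * (((J : ℝ) + 1) ^ 8 * (1 - p : ℝ) ^ J) := by
                gcongr
                linarith
            _ = _ := by ring
        have e2 : (J : ℝ) * (J * (n / t ^ 2)) ≤ 1 / J := by
          have : (J : ℝ) * (J * (n / t ^ 2)) = J ^ 6 / n := by
            rw [ht]
            field_simp
          rw [this, div_le_div_iff₀ hn0' (by linarith)]
          calc (J : ℝ) ^ 6 * J = J ^ 7 := by ring
            _ ≤ (J : ℝ) ^ 8 := pow_le_pow_right₀ (by linarith) (by norm_num)
            _ ≤ 1 * n := by linarith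
        linarith

end Whp

theorem theorem2 (p : ℝ) (hp0 : 0 < p) (hp1 : p < 1) :
    (1 - 1 / (7 : ℝ) ^ (1 / 3 : ℝ) < p →
      WhpSatC4Le ⟨p, hp0.le, hp1.le⟩
        (3 * (1 + (1 - p) ^ 3) / (2 * (1 - (1 - p) ^ 3)))) ∧
    (p ≤ 1 - 1 / (7 : ℝ) ^ (1 / 3 : ℝ) →
      ∃ s : ℕ, IsLeast {t : ℕ | 0 < t ∧ (2 * (t : ℝ) ^ 2 + 1) * (1 - p) ^ t < 1} s ∧
        WhpSatC4Le ⟨p, hp0.le, hp1.le⟩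
          (((s : ℝ) + 1) / 2 + s * (1 - p) ^ s
            + s * (1 - p) ^ (2 * s) / (1 - (1 - p) ^ s))) ∧
    (p = 1 / 2 → WhpSatC4Le ⟨p, hp0.le, hp1.le⟩ (27 / 14)) := by
  have hq0 : 0 < 1 - p := by linarith
  have hq1 : 1 - p < 1 := by linarith
  have hroot : (0 : ℝ) < 1 / (7 : ℝ) ^ (1 / 3 : ℝ) := by positivity
  have hmain := whpSatC4Le_starConst ⟨p, hp0.le, hp1.le⟩ hp0 hp1
  simp only at hmain
  have hnonneg : 0 ≤ starConst (1 - p) := by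
    unfold starConst
    rw [sub_sub_cancel]
    positivity
  refine ⟨fun h => ?_, fun h => ?_, fun h => ?_⟩
  · refine hmain.mono hnonneg (starConst_le_of_pow_lt hq0 ?_)
    rw [← seven_rpow_third_cube]
    exact pow_lt_pow_left₀ (by linarith) hq0.le (by norm_num)
  · have hq : 1 / 2 ≤ 1 - p := by
      by_contra! hlt
      have h1 := pow_le_pow_left₀ hroot.le (show 1 / (7 : ℝ) ^ (1 / 3 : ℝ) ≤ 1 - p by linarith) 3
      have h2 := pow_lt_pow_left₀ hlt hq0.le (show 3 ≠ 0 by norm_num)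
      rw [seven_rpow_third_cube] at h1
      norm_num at h2
      linarith
    classical
    have hex := exists_pos_two_mul_sq_add_one_mul_pow_lt_one hq0 hq1
    refine ⟨Nat.find hex, ⟨Nat.find_spec hex, fun t ht => Nat.find_min' hex ht⟩, ?_⟩
    exact hmain.mono hnonneg
      (starConst_le_of_half_le hq1 hq (Nat.find_spec hex).1 (Nat.find_spec hex).2)
  · subst h
    refine hmain.mono hnonneg ((starConst_le_of_pow_lt hq0 ?_).trans (le_of_eq ?_)) <;> norm_num
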